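/- Let $n,j,k\in\mathbb N$ with $n\ge 1$ and $1\le j<k$, and let $X,Y$ be rearrangement-invariant Banach function spaces over $\mathbb R^n$ with Lebesgue measure (in the sense of Bennett--Sharpley). For a functional $\|\cdot\|_Z$ on measurable functions and $\alpha>0$ put $\|f\|_{Z^{\alpha}}:=\big\||f|^{\alpha}\big\|_Z^{1/\alpha}$; for functionals $\|\cdot\|_W,\|\cdot\|_X$ put $\|f\|_{W^{X}}:=\sup_{\|g\|_W\le 1}\|fg\|_X$. We say that $W$ is locally embedded into $X$ if for every measurable $E\subset\mathbb R^n$ with $|E|<\infty$ there is a constant $C_E<\infty$ such that $\|f\chi_E\|_X\le C_E\|f\chi_E\|_W$ for all measurable $f$. For a scalar- or vector-valued measurable function $f$ let $f^*(t):=\inf\{s\in(0,\infty):|\{|f|>s\}|\le t\}$ (with $\inf\emptyset=\infty$) and $f^{**}(t):=\frac1t\int_0^t f^*(s)\,ds$ for $t>0$. For a function $h$ on $(0,\infty)$ and a rearrangement-invariant functional $\|\cdot\|_Z$ over $\mathbb R^n$, $\|h\|_Z$ denotes the norm of $h$ in the Luxemburg representation of $Z$ over $(0,\infty)$, that is, the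 value of $\|\cdot\|_Z$ at the function $x\mapsto h^*(|B(0,|x|)|)$ on $\mathbb R^n$, which is equimeasurable with $h$ (so that $\|f\|_Z=\|f^*\|_Z$). Assume that $Y^{k/j}$ is locally embedded into $X$. Then there is a constant $C<\infty$ such that for all $k$-times weakly differentiable functions $u:\mathbb R^n\to\mathbb R$ (that is, $u$ and its weak partial derivatives of all orders up to $k$ are locally integrable functions) $$ \|\nabla^j u\|_{X}\le C\,\|(\nabla^k u)^{**}\|_{Y}^{\frac jk}\;\|u^{**}\|_{((Y^{k/j})^{X})^{1-\frac jk}}^{1-\frac jk}, $$ except when the right-hand side is the indeterminate product $0\cdot\infty$, that is, when $\|(\nabla^k u)^{**}\|_Y=0$ and $\|u^{**}\|_{((Y^{k/j})^{X})^{1-j/k}}=\infty$. Here $\nabla^m u$ is the vector of all weak partial derivatives $\partial_{i_1}\cdots\partial_{i_m}u$, $1\le i_1,\dots,i_m\le n$, with the Euclidean norm. Norms may take the value $\infty$. -/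

import Mathlib

open MeasureTheory Set
open scoped ENNReal NNReal

noncomputable section

/-- Euclidean `n`-space. -/
abbrev RSpace (n : ℕ) : Type := EuclideanSpace ℝ (Fin n)

/-! ### Banach function norms

A function norm is a functional on the `[0, ∞]`-valued measurable functions; the norm of a scalar
or vector valued function `u` is its value at `x ↦ ‖u x‖ₑ`. -/

/-- Banach function norms (Bennett--Sharpley). "Measurable" means measurable up to a null set. -/
structure IsBanachFunctionNorm {α : Type*} [MeasurableSpace α] (μ : Measure α)
    (ρ : (α → ℝ≥0∞) → ℝ≥0∞) : Prop where
  eq_zero_iff : ∀ f, AEMeasurable f μ → (ρ f = 0 ↔ f =ᵐ[μ] 0)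
  smul : ∀ (c : ℝ≥0) (f), AEMeasurable f μ → ρ (fun x => c * f x) = c * ρ f
  add_le : ∀ f g, AEMeasurable f μ → AEMeasurable g μ → ρ (fun x => f x + g x) ≤ ρ f + ρ g
  mono : ∀ f g, AEMeasurable f μ → AEMeasurable g μ → f ≤ᵐ[μ] g → ρ f ≤ ρ g
  /-- The Fatou property. -/
  iSup_eq : ∀ F : ℕ → α → ℝ≥0∞, (∀ m, AEMeasurable (F m) μ) →
    (∀ᵐ x ∂μ, Monotone fun m => F m x) → ρ (fun x => ⨆ m, F m x) = ⨆ m, ρ (F m)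
  indicator_lt_top : ∀ E, MeasurableSet E → μ E < ∞ → ρ (E.indicator fun _ => 1) < ∞
  setLIntegral_le : ∀ E, MeasurableSet E → μ E < ∞ →
    ∃ C : ℝ≥0, ∀ f, AEMeasurable f μ → ∫⁻ x in E, f x ∂μ ≤ C * ρ f

/-- Rearrangement-invariant Banach function norms: equimeasurable functions have equal norm. -/
structure IsRIBanachFunctionNorm {α : Type*} [MeasurableSpace α] (μ : Measure α)
    (ρ : (α → ℝ≥0∞) → ℝ≥0∞) : Prop extends IsBanachFunctionNorm μ ρ where
  eq_of_equimeasurable : ∀ f g, AEMeasurable f μ → AEMeasurable g μ →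
    (∀ s : ℝ≥0∞, μ {x | s < f x} = μ {x | s < g x}) → ρ f = ρ g

/-- The norm of the `a`-convexification `X^a`: `‖u‖_{X^a} = ‖|u|^a‖_X^{1/a}`. -/
def convexification {α : Type*} (ρ : (α → ℝ≥0∞) → ℝ≥0∞) (a : ℝ) (f : α → ℝ≥0∞) : ℝ≥0∞ :=
  ρ (fun x => f x ^ a) ^ (1 / a)

/-- The norm of the space `Y^X` of Hölder multipliers:
`‖f‖_{Y^X} = sup {‖f g‖_X : ‖g‖_Y ≤ 1}`. -/
def multiplierNorm {α : Type*} [MeasurableSpace α] (μ : Measure α)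
    (ρY ρX : (α → ℝ≥0∞) → ℝ≥0∞) (f : α → ℝ≥0∞) : ℝ≥0∞ :=
  ⨆ (g : α → ℝ≥0∞) (_ : AEMeasurable g μ) (_ : ρY g ≤ 1), ρX (fun x => f x * g x)

/-- `Y` is locally embedded into `X`. -/
def LocallyEmbedded {α : Type*} [MeasurableSpace α] (μ : Measure α)
    (ρY ρX : (α → ℝ≥0∞) → ℝ≥0∞) : Prop :=
  ∀ E, MeasurableSet E → μ E < ∞ → ∃ C : ℝ≥0, ∀ f, AEMeasurable f μ →
    ρX (E.indicator f) ≤ C * ρY (E.indicator f)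

/-! ### Rearrangements -/

/-- The non-increasing rearrangement `f^*(t)`, for `t > 0`. -/
def rearrangement {α : Type*} [MeasurableSpace α] (μ : Measure α) (f : α → ℝ≥0∞) (t : ℝ) :
    ℝ≥0∞ :=
  sInf {s : ℝ≥0∞ | 0 < s ∧ s < ∞ ∧ μ {x | s < f x} ≤ ENNReal.ofReal t}

/-- The maximal function `f^{**}(t) = (1/t) ∫₀ᵗ f^*(s) ds`, for `t > 0`. -/
def maximalRearrangement {α : Type*} [MeasurableSpace α] (μ : Measure α) (f : α → ℝ≥0∞) (t : ℝ) :
    ℝ≥0∞ :=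
  (ENNReal.ofReal t)⁻¹ * ∫⁻ s in Ioo 0 t, rearrangement μ f s

/-- The radially non-increasing function `x ↦ f^*(|B(0,|x|)|)` on `ℝⁿ` that is equimeasurable with
a given function `f` on `(0, ∞)`. -/
def radialRearrangement (n : ℕ) (f : ℝ → ℝ≥0∞) (x : RSpace n) : ℝ≥0∞ :=
  rearrangement (volume.restrict (Ioi 0)) f (volume (Metric.ball (0 : RSpace n) ‖x‖)).toReal

/-- The Luxemburg representation over `(0, ∞)` of a rearrangement-invariant functional `ρ` over
`ℝⁿ`: the value at a function `f` on `(0, ∞)` is the value of `ρ` at a function on `ℝⁿ` that is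
equimeasurable with `f`. It satisfies `representation ρ u^* = ρ u`; see
`representation_rearrangement` below. -/
def representation {n : ℕ} (ρ : (RSpace n → ℝ≥0∞) → ℝ≥0∞) (f : ℝ → ℝ≥0∞) : ℝ≥0∞ :=
  ρ (radialRearrangement n f)

/-! ### Weak derivatives -/

/-- `v` is the weak gradient `∇^m u` of order `m`: the vector, normed by the Euclidean norm, of all
weak partial derivatives `∂_{i₁} ⋯ ∂_{iₘ} u`, which are locally integrable functions. -/
def IsWeakGradient {n : ℕ} (m : ℕ) (u : RSpace n → ℝ)
    (v : RSpace n → EuclideanSpace ℝ (Fin m → Fin n)) : Prop :=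
  ∀ i : Fin m → Fin n, LocallyIntegrable (fun x => v x i) ∧
    ∀ φ : RSpace n → ℝ, ContDiff ℝ (⊤ : ℕ∞) φ → HasCompactSupport φ →
      ∫ x, u x * iteratedFDeriv ℝ m φ x (fun l => EuclideanSpace.single (i l) 1)
        = (-1) ^ m * ∫ x, v x i * φ x

/-- `u` is `k`-times weakly differentiable: it is locally integrable and has locally integrable
weak partial derivatives of all orders up to `k`. -/
def WeaklyDifferentiable {n : ℕ} (k : ℕ) (u : RSpace n → ℝ) : Prop :=
  LocallyIntegrable u ∧ ∀ m ≤ k, ∃ v, IsWeakGradient m u v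


theorem lt_rearrangement_iff {α : Type*} [MeasurableSpace α] (μ : Measure α) (f : α → ℝ≥0∞)
    (s : ℝ≥0∞) (t : ℝ) :
    s < rearrangement μ f t ↔ ENNReal.ofReal t < μ {x | s < f x} := by
  rw [← not_le, ← not_le, not_iff_not]
  constructor
  · intro h
    rcases eq_or_ne s ∞ with rfl | hs
    · simp
    obtain ⟨v, hv, hvs, hvt⟩ := exists_seq_strictAnti_tendsto' (lt_top_iff_ne_top.2 hs)
    have hU : {x | s < f x} = ⋃ m, {x | v m < f x} := by
      ext x
      simp only [mem_ofPred_eq, mem_iUnion]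
      refine ⟨fun hx => ((hvt.eventually (gt_mem_nhds hx)).exists), ?_⟩
      rintro ⟨m, hm⟩
      exact (hvs m).1.trans hm
    have hmono : Monotone fun m => {x | v m < f x} := by
      intro a b hab x hx
      exact (hv.antitone hab).trans_lt hx
    rw [hU, hmono.measure_iUnion]
    refine iSup_le fun m => ?_
    obtain ⟨r, hr, hrv⟩ := sInf_lt_iff.1 (h.trans_lt (hvs m).1)
    exact (measure_mono fun x (hx : v m < f x) => hrv.trans hx).trans hr.2.2
  · intro h
    rcases eq_or_ne s ∞ with rfl | hs
    · simp
    refine le_of_forall_gt fun r hr => ?_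
    obtain ⟨q, hq1, hq2⟩ := exists_between hr
    refine lt_of_le_of_lt (sInf_le ⟨(zero_le).trans_lt hq1, hq2.trans_le le_top, ?_⟩) hq2
    exact (measure_mono fun x (hx : q < f x) => hq1.trans hx).trans h

theorem volume_ball_norm_lt {n : ℕ} (hn : 1 ≤ n) (d : ℝ≥0∞) :
    volume {x : RSpace n | volume (Metric.ball (0 : RSpace n) ‖x‖) < d} = d := by
  have : Nonempty (Fin n) := ⟨⟨0, hn⟩⟩
  have : Nontrivial (RSpace n) := inferInstance
  have hb : ∀ r : ℝ, 0 ≤ r → volume (Metric.ball (0 : RSpace n) r)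
      = ENNReal.ofReal (r ^ n) * volume (Metric.ball (0 : RSpace n) 1) := by
    intro r hr
    have := Measure.addHaar_ball (volume : Measure (RSpace n)) 0 hr
    simpa using this
  set c := volume (Metric.ball (0 : RSpace n) 1) with hc
  have hc0 : c ≠ 0 := (Metric.measure_ball_pos _ _ one_pos).ne'
  have hct : c ≠ ∞ := measure_ball_lt_top.ne
  rcases eq_or_ne d ∞ with rfl | hd
  · have : {x : RSpace n | volume (Metric.ball (0 : RSpace n) ‖x‖) < ∞} = univ := by
      ext x; simp [measure_ball_lt_top]
    rw [this]
    simp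
  set R : ℝ := ((d / c).toReal) ^ ((1 : ℝ) / n)
  have hR : 0 ≤ R := by positivity
  have hRn : R ^ n = (d / c).toReal := by
    have hn' : (n : ℝ) ≠ 0 := by positivity
    rw [← Real.rpow_natCast, ← Real.rpow_mul (by positivity)]
    simp [hn']
  have hdc : d / c ≠ ∞ := ENNReal.div_ne_top hd hc0
  have hd' : volume (Metric.ball (0 : RSpace n) R) = d := by
    rw [hb R hR, hRn, ENNReal.ofReal_toReal hdc, ENNReal.div_mul_cancel hc0 hct]
  have : {x : RSpace n | volume (Metric.ball (0 : RSpace n) ‖x‖) < d} = Metric.ball 0 R := by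
    ext x
    simp only [mem_ofPred_eq, mem_ball_zero_iff]
    rw [hb _ (norm_nonneg x), ← hd', hb R hR, ENNReal.mul_lt_mul_iff_left hc0 hct,
      ENNReal.ofReal_lt_ofReal_iff_of_nonneg (by positivity)]
    exact pow_lt_pow_iff_left₀ (norm_nonneg x) hR (by omega)
  rw [this, hd']

/-- `radialRearrangement n f` is equimeasurable with `f`. -/
theorem volume_lt_radialRearrangement {n : ℕ} (hn : 1 ≤ n) (f : ℝ → ℝ≥0∞) (s : ℝ≥0∞) :
    volume {x | s < radialRearrangement n f x} = volume.restrict (Ioi 0) {t | s < f t} := by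
  simp only [radialRearrangement, lt_rearrangement_iff,
    ENNReal.ofReal_toReal measure_ball_lt_top.ne]
  exact volume_ball_norm_lt hn _

theorem volume_lt_rearrangement {α : Type*} [MeasurableSpace α] (μ : Measure α) (f : α → ℝ≥0∞)
    (s : ℝ≥0∞) :
    volume.restrict (Ioi 0) {t | s < rearrangement μ f t} = μ {x | s < f x} := by
  simp only [lt_rearrangement_iff]
  rw [Measure.restrict_apply' measurableSet_Ioi]
  rcases eq_or_ne (μ {x | s < f x}) ∞ with h | h
  · simp [h]
  · have : {t : ℝ | ENNReal.ofReal t < μ {x | s < f x}} ∩ Ioi 0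
        = Ioo 0 (μ {x | s < f x}).toReal := by
      ext t
      simp only [mem_inter_iff, mem_ofPred_eq, mem_Ioi, mem_Ioo]
      constructor
      · rintro ⟨h1, h2⟩
        exact ⟨h2, (ENNReal.ofReal_lt_iff_lt_toReal h2.le h).1 h1⟩
      · rintro ⟨h1, h2⟩
        exact ⟨(ENNReal.ofReal_lt_iff_lt_toReal h1.le h).2 h2, h1⟩
    rw [this, Real.volume_Ioo]
    simp [ENNReal.ofReal_toReal h]

theorem measurable_radialRearrangement (n : ℕ) (f : ℝ → ℝ≥0∞) :
    Measurable (radialRearrangement n f) := by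
  have h1 : Antitone (rearrangement (volume.restrict (Ioi 0)) f) := by
    intro a b hab
    refine le_of_forall_lt fun s hs => ?_
    rw [lt_rearrangement_iff] at hs ⊢
    exact (ENNReal.ofReal_le_ofReal hab).trans_lt hs
  have h2 : Monotone fun r : ℝ => (volume (Metric.ball (0 : RSpace n) r)).toReal := by
    intro a b hab
    exact ENNReal.toReal_mono measure_ball_lt_top.ne (measure_mono (Metric.ball_subset_ball hab))
  exact (h1.measurable.comp h2.measurable).comp measurable_norm

/-- The defining property `‖u‖_X = ‖u^*‖` of the Luxemburg representation. -/
theorem representation_rearrangement {n : ℕ} (hn : 1 ≤ n) {ρ : (RSpace n → ℝ≥0∞) → ℝ≥0∞}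
    (hρ : IsRIBanachFunctionNorm volume ρ) {f : RSpace n → ℝ≥0∞} (hf : AEMeasurable f volume) :
    representation ρ (rearrangement volume f) = ρ f :=
  hρ.eq_of_equimeasurable _ _ (measurable_radialRearrangement n _).aemeasurable hf fun s => by
    rw [volume_lt_radialRearrangement hn, volume_lt_rearrangement]

end

/-
Writing `N_t(f)` for the supremum of the integrals `∫ f dν` over the measures `ν ≤ μ` of total
mass at most `t`, one has `N_t(f) = t f^{**}(t)` on a nonatomic space. This is a
translation-invariant norm, so it does not increase under mollification, and Landau's inequality
`r N_t(∂w) ≤ 2 N_t(w) + r² N_t(∂²w)`, taken along coordinate directions, makes the norms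
`N_t(∇^m u)` logarithmically convex in `m` up to constants. Dividing by `t`,
`(∇^j u)^*(t) ≤ C (∇^k u)^{**}(t)^{j/k} u^{**}(t)^{1-j/k}` pointwise, and the theorem follows by
applying `‖·‖_X` and the Hölder inequality that defines the multiplier space.
-/

noncomputable section

section Rearrangement

theorem volume_restrict_Ioi_ofReal_lt (d : ℝ≥0∞) :
    volume.restrict (Ioi 0) {t : ℝ | ENNReal.ofReal t < d} = d := by
  rw [Measure.restrict_apply' measurableSet_Ioi]
  rcases eq_or_ne d ∞ with rfl | hd
  · simp
  · have : {t : ℝ | ENNReal.ofReal t < d} ∩ Ioi 0 = Ioo 0 d.toReal := by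
      ext t
      simp only [mem_inter_iff, mem_ofPred_eq, mem_Ioi, mem_Ioo]
      exact ⟨fun h => ⟨h.2, (ENNReal.ofReal_lt_iff_lt_toReal h.2.le hd).1 h.1⟩,
        fun h => ⟨(ENNReal.ofReal_lt_iff_lt_toReal h.1.le hd).2 h.2, h.1⟩⟩
    rw [this, Real.volume_Ioo, sub_zero, ENNReal.ofReal_toReal hd]

variable {α : Type*} [MeasurableSpace α] {μ : Measure α} {f g : α → ℝ≥0∞}

theorem lintegral_eq_lintegral_measure_ofReal_lt [SFinite μ] (hf : Measurable f) :
    ∫⁻ x, f x ∂μ = ∫⁻ s in Ioi (0 : ℝ), μ {x | ENNReal.ofReal s < f x} := by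
  have hA : MeasurableSet {p : α × ℝ | ENNReal.ofReal p.2 < f p.1} :=
    measurableSet_lt (by fun_prop) (by fun_prop)
  calc ∫⁻ x, f x ∂μ
      = ∫⁻ x, volume.restrict (Ioi 0) {s : ℝ | ENNReal.ofReal s < f x} ∂μ := by
        simp only [volume_restrict_Ioi_ofReal_lt]
    _ = μ.prod (volume.restrict (Ioi 0)) {p : α × ℝ | ENNReal.ofReal p.2 < f p.1} :=
        (Measure.prod_apply hA).symm
    _ = ∫⁻ s in Ioi (0 : ℝ), μ {x | ENNReal.ofReal s < f x} := Measure.prod_apply_symm hA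

theorem rearrangement_antitone (μ : Measure α) (f : α → ℝ≥0∞) :
    Antitone (rearrangement μ f) := by
  intro a b hab
  refine le_of_forall_lt fun s hs => ?_
  rw [lt_rearrangement_iff] at hs ⊢
  exact (ENNReal.ofReal_le_ofReal hab).trans_lt hs

theorem rearrangement_congr_ae (h : f =ᵐ[μ] g) : rearrangement μ f = rearrangement μ g := by
  ext t
  refine eq_of_forall_lt_iff fun s => ?_
  have : μ {x | s < f x} = μ {x | s < g x} :=
    measure_congr (h.mono fun x hx => congrArg (s < ·) hx)
  rw [lt_rearrangement_iff, lt_rearrangement_iff, this]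

theorem rearrangement_rearrangement (μ : Measure α) (f : α → ℝ≥0∞) :
    rearrangement (volume.restrict (Ioi 0)) (rearrangement μ f) = rearrangement μ f := by
  ext t
  refine eq_of_forall_lt_iff fun s => ?_
  rw [lt_rearrangement_iff, lt_rearrangement_iff, volume_lt_rearrangement]

theorem radialRearrangement_rearrangement (n : ℕ) (μ : Measure α) (f : α → ℝ≥0∞)
    (x : RSpace n) :
    radialRearrangement n (rearrangement μ f) x
      = rearrangement μ f (volume (Metric.ball (0 : RSpace n) ‖x‖)).toReal := by
  rw [radialRearrangement, rearrangement_rearrangement]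

theorem le_rearrangement_of_antitoneOn {h : ℝ → ℝ≥0∞} (hh : AntitoneOn h (Ioi 0)) {s t : ℝ}
    (hs : 0 ≤ s) (hst : s < t) : h t ≤ rearrangement (volume.restrict (Ioi 0)) h s := by
  have ht : 0 < t := hs.trans_lt hst
  refine le_of_forall_lt fun c hc => ?_
  rw [lt_rearrangement_iff, Measure.restrict_apply' measurableSet_Ioi]
  calc ENNReal.ofReal s < ENNReal.ofReal t := (ENNReal.ofReal_lt_ofReal_iff ht).2 hst
    _ = volume (Ioc 0 t) := by rw [Real.volume_Ioc, sub_zero]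
    _ ≤ volume ({x | c < h x} ∩ Ioi 0) :=
      measure_mono fun x hx => ⟨hc.trans_le (hh hx.1 ht hx.2), hx.1⟩

theorem ofReal_mul_maximalRearrangement (μ : Measure α) (f : α → ℝ≥0∞) {t : ℝ} (ht : 0 < t) :
    ENNReal.ofReal t * maximalRearrangement μ f t = ∫⁻ s in Ioo 0 t, rearrangement μ f s := by
  rw [maximalRearrangement, ← mul_assoc,
    ENNReal.mul_inv_cancel (ENNReal.ofReal_pos.2 ht).ne' ENNReal.ofReal_ne_top, one_mul]

theorem maximalRearrangement_eq_lintegral (μ : Measure α) (f : α → ℝ≥0∞) {t : ℝ} (ht : 0 < t) :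
    maximalRearrangement μ f t = ∫⁻ s in Ioo (0 : ℝ) 1, rearrangement μ f (t * s) := by
  have hpre : (t * ·) ⁻¹' Ioo 0 t = Ioo 0 1 := by
    rw [preimage_const_mul_Ioo₀ _ _ ht, zero_div, div_self ht.ne']
  have hmap : volume.map (t * ·) = (ENNReal.ofReal t)⁻¹ • (volume : Measure ℝ) := by
    rw [Real.map_volume_mul_left ht.ne', abs_of_pos (by positivity), ENNReal.ofReal_inv_of_pos ht]
  have hme : MeasurableEmbedding (t * ·) := (Homeomorph.mulLeft₀ t ht.ne').measurableEmbedding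
  rw [← hpre, ← hme.lintegral_map (μ := volume.restrict _), ← hme.restrict_map, hmap,
    Measure.restrict_smul, lintegral_smul_measure, smul_eq_mul, maximalRearrangement]

theorem maximalRearrangement_antitoneOn (μ : Measure α) (f : α → ℝ≥0∞) :
    AntitoneOn (maximalRearrangement μ f) (Ioi 0) := by
  intro s hs t ht hst
  rw [maximalRearrangement_eq_lintegral μ f hs, maximalRearrangement_eq_lintegral μ f ht]
  exact setLIntegral_mono' measurableSet_Ioo fun x hx =>
    rearrangement_antitone μ f (mul_le_mul_of_nonneg_right hst hx.1.le)

theorem maximalRearrangement_le_mul (μ : Measure α) (f : α → ℝ≥0∞) {s t : ℝ} (hs : 0 < s)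
    (hst : s ≤ t) :
    maximalRearrangement μ f s ≤ ENNReal.ofReal (t / s) * maximalRearrangement μ f t := by
  rw [div_eq_inv_mul, ENNReal.ofReal_mul (inv_nonneg.2 hs.le), mul_assoc,
    ofReal_mul_maximalRearrangement μ f (hs.trans_le hst), ENNReal.ofReal_inv_of_pos hs]
  exact mul_le_mul_right (lintegral_mono_set (Ioo_subset_Ioo_right hst)) _

theorem maximalRearrangement_le_rearrangement (μ : Measure α) (f : α → ℝ≥0∞) {t : ℝ}
    (ht : 0 < t) :
    maximalRearrangement μ f t
      ≤ rearrangement (volume.restrict (Ioi 0)) (maximalRearrangement μ f) t := by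
  set R := rearrangement (volume.restrict (Ioi 0)) (maximalRearrangement μ f) t
  have hbound : ∀ r ∈ Ioi t, maximalRearrangement μ f t ≤ ENNReal.ofReal (r / t) * R :=
    fun r hr => (maximalRearrangement_le_mul μ f ht (mem_Ioi.1 hr).le).trans <| by
      gcongr
      exact le_rearrangement_of_antitoneOn (maximalRearrangement_antitoneOn μ f) ht.le hr
  have hlim : Filter.Tendsto (fun r => ENNReal.ofReal (r / t) * R) (nhdsWithin t (Ioi t))
      (nhds (ENNReal.ofReal (t / t) * R)) := by
    refine ENNReal.Tendsto.mul_const ?_ (Or.inl (by simp [ht.ne']))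
    exact (ENNReal.continuous_ofReal.comp (continuous_id.div_const t)).continuousAt.mono_left
      nhdsWithin_le_nhds
  rw [div_self ht.ne', ENNReal.ofReal_one, one_mul] at hlim
  exact ge_of_tendsto hlim (eventually_mem_nhdsWithin.mono hbound)

end Rearrangement

section KyFanNorm

variable {α β : Type*} [MeasurableSpace α] [MeasurableSpace β] {μ ν : Measure α} {t : ℝ}
  {f g : α → ℝ≥0∞}

/-- The Ky Fan norm, the `K`-functional `K(t, f; L¹, L^∞)`: the largest integral of `f` against a
measure below `μ` of total mass at most `t`. On a nonatomic space these measures can be restricted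
to the `μ.restrict E` with `μ E ≤ t`; allowing all of them makes the notion work on any space. -/
def kyFanNorm (μ : Measure α) (t : ℝ) (f : α → ℝ≥0∞) : ℝ≥0∞ :=
  ⨆ (ν : Measure α) (_ : ν ≤ μ) (_ : ν univ ≤ ENNReal.ofReal t), ∫⁻ x, f x ∂ν

theorem lintegral_le_kyFanNorm (f : α → ℝ≥0∞) (hνμ : ν ≤ μ) (hν : ν univ ≤ ENNReal.ofReal t) :
    ∫⁻ x, f x ∂ν ≤ kyFanNorm μ t f :=
  le_iSup₂_of_le ν hνμ (le_iSup_of_le hν le_rfl)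

theorem kyFanNorm_le {c : ℝ≥0∞}
    (h : ∀ ν ≤ μ, ν univ ≤ ENNReal.ofReal t → ∫⁻ x, f x ∂ν ≤ c) : kyFanNorm μ t f ≤ c :=
  iSup₂_le fun ν hνμ => iSup_le (h ν hνμ)

theorem kyFanNorm_mono (h : f ≤ g) : kyFanNorm μ t f ≤ kyFanNorm μ t g :=
  kyFanNorm_le fun _ hνμ hν => (lintegral_mono h).trans (lintegral_le_kyFanNorm g hνμ hν)

theorem kyFanNorm_add_le (hf : AEMeasurable f μ) (g : α → ℝ≥0∞) :
    kyFanNorm μ t (fun x => f x + g x) ≤ kyFanNorm μ t f + kyFanNorm μ t g := by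
  refine kyFanNorm_le fun ν hνμ hν => ?_
  rw [lintegral_add_left' (hf.mono_measure hνμ)]
  exact add_le_add (lintegral_le_kyFanNorm f hνμ hν) (lintegral_le_kyFanNorm g hνμ hν)

theorem kyFanNorm_sum_le {ι : Type*} (s : Finset ι) {F : ι → α → ℝ≥0∞}
    (hF : ∀ i ∈ s, AEMeasurable (F i) μ) :
    kyFanNorm μ t (fun x => ∑ i ∈ s, F i x) ≤ ∑ i ∈ s, kyFanNorm μ t (F i) := by
  refine kyFanNorm_le fun ν hνμ hν => ?_
  rw [lintegral_finsetSum' _ fun i hi => (hF i hi).mono_measure hνμ]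
  exact Finset.sum_le_sum fun i _ => lintegral_le_kyFanNorm (F i) hνμ hν

theorem kyFanNorm_const_mul {c : ℝ≥0∞} (hc : c ≠ ∞) (f : α → ℝ≥0∞) :
    kyFanNorm μ t (fun x => c * f x) = c * kyFanNorm μ t f := by
  simp only [kyFanNorm, lintegral_const_mul' c f hc, ENNReal.mul_iSup]

theorem kyFanNorm_comp_le {μ' : Measure β} {T : α → β} (hT : MeasurePreserving T μ μ')
    {f : β → ℝ≥0∞} (hf : AEMeasurable f μ') :
    kyFanNorm μ t (fun x => f (T x)) ≤ kyFanNorm μ' t f := by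
  refine kyFanNorm_le fun ν hνμ hν => ?_
  have hle : ν.map T ≤ μ' := hT.map_eq ▸ Measure.map_mono hνμ hT.measurable
  rw [← lintegral_map' (hf.mono_measure hle) hT.measurable.aemeasurable]
  exact lintegral_le_kyFanNorm f hle (by rwa [Measure.map_apply hT.measurable .univ])

theorem kyFanNorm_lintegral_le {lam : Measure β} [SFinite lam] {F : β → α → ℝ≥0∞}
    (hF : AEMeasurable (fun p : α × β => F p.2 p.1) (μ.prod lam)) :
    kyFanNorm μ t (fun x => ∫⁻ y, F y x ∂lam) ≤ ∫⁻ y, kyFanNorm μ t (F y) ∂lam := by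
  refine kyFanNorm_le fun ν hνμ hν => ?_
  have : IsFiniteMeasure ν := ⟨hν.trans_lt ENNReal.ofReal_lt_top⟩
  rw [lintegral_lintegral_swap (hF.mono_ac (Measure.AbsolutelyContinuous.prod
    (Measure.absolutelyContinuous_of_le hνμ) .rfl))]
  exact lintegral_mono fun y => lintegral_le_kyFanNorm (F y) hνμ hν

theorem kyFanNorm_le_of_ae_tendsto {F : ℕ → α → ℝ≥0∞} {c : ℝ≥0∞}
    (hF : ∀ m, AEMeasurable (F m) μ) (hc : ∀ m, kyFanNorm μ t (F m) ≤ c)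
    (hlim : ∀ᵐ x ∂μ, Filter.Tendsto (F · x) Filter.atTop (nhds (f x))) :
    kyFanNorm μ t f ≤ c := by
  refine kyFanNorm_le fun ν hνμ hν => ?_
  calc ∫⁻ x, f x ∂ν = ∫⁻ x, Filter.liminf (F · x) Filter.atTop ∂ν :=
        lintegral_congr_ae ((hlim.filter_mono (ae_mono hνμ)).mono
          fun x hx => hx.liminf_eq.symm)
    _ ≤ Filter.liminf (fun m => ∫⁻ x, F m x ∂ν) Filter.atTop :=
        lintegral_liminf_le' fun m => (hF m).mono_measure hνμ
    _ ≤ c := Filter.liminf_le_of_frequently_le' (.of_forall fun m =>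
        (lintegral_le_kyFanNorm (F m) hνμ hν).trans (hc m))

theorem kyFanNorm_le_lintegral_rearrangement (hf : AEMeasurable f μ) (t : ℝ) :
    kyFanNorm μ t f ≤ ∫⁻ s in Ioo 0 t, rearrangement μ f s := by
  refine kyFanNorm_le fun ν hνμ hν => ?_
  have : IsFiniteMeasure ν := ⟨hν.trans_lt ENNReal.ofReal_lt_top⟩
  obtain ⟨g, hg, hfg⟩ := hf
  rw [rearrangement_congr_ae hfg, lintegral_congr_ae (ae_mono hνμ hfg),
    lintegral_eq_lintegral_measure_ofReal_lt hg,
    lintegral_eq_lintegral_measure_ofReal_lt (rearrangement_antitone μ g).measurable]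
  refine lintegral_mono fun s => ?_
  set d := μ {x | ENNReal.ofReal s < g x}
  have hsub : {r : ℝ | ENNReal.ofReal r < min d (ENNReal.ofReal t)} ∩ Ioi 0
      ⊆ {r | ENNReal.ofReal r < d} ∩ Ioo 0 t := by
    rintro r ⟨(hr : ENNReal.ofReal r < _), hr0⟩
    obtain ⟨hrd, hrt⟩ := lt_min_iff.1 hr
    exact ⟨hrd, hr0, (ENNReal.ofReal_lt_ofReal_iff_of_nonneg (mem_Ioi.1 hr0).le).1 hrt⟩
  simp only [lt_rearrangement_iff]
  calc ν {x | ENNReal.ofReal s < g x} ≤ min d (ENNReal.ofReal t) :=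
        le_min (hνμ _) ((measure_mono (subset_univ _)).trans hν)
    _ = volume.restrict (Ioi 0) {r : ℝ | ENNReal.ofReal r < min d (ENNReal.ofReal t)} :=
        (volume_restrict_Ioi_ofReal_lt _).symm
    _ ≤ volume.restrict (Ioo 0 t) {r | ENNReal.ofReal r < d} := by
        rw [Measure.restrict_apply' measurableSet_Ioi, Measure.restrict_apply' measurableSet_Ioo]
        exact measure_mono hsub

theorem ofReal_mul_rearrangement_le_kyFanNorm [SigmaFinite μ] (hf : AEMeasurable f μ) (t : ℝ) :
    ENNReal.ofReal t * rearrangement μ f t ≤ kyFanNorm μ t f := by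
  refine ENNReal.mul_le_of_forall_lt fun r hr s hs => ?_
  obtain ⟨A, hAf, hA, hAf'⟩ :=
    (nullMeasurableSet_lt aemeasurable_const hf).exists_measurable_subset_ae_eq
  rw [lt_rearrangement_iff, ← measure_congr hAf'] at hs
  obtain ⟨S, hS, hSA, hSt, hS_top⟩ := Measure.exists_subset_measure_lt_top hA hs
  have hS0 : μ S ≠ 0 := (bot_le.trans_lt hSt).ne'
  have hmass : ENNReal.ofReal t / μ S * μ S = ENNReal.ofReal t :=
    ENNReal.div_mul_cancel hS0 hS_top.ne
  calc r * s ≤ ENNReal.ofReal t / μ S * (s * μ S) := by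
        rw [mul_left_comm, hmass, mul_comm]; gcongr
    _ ≤ ENNReal.ofReal t / μ S * ∫⁻ x in S, f x ∂μ := by
        gcongr
        rw [← setLIntegral_const]
        exact setLIntegral_mono' hS fun x hx => (hAf (hSA hx)).le
    _ = ∫⁻ x, f x ∂((ENNReal.ofReal t / μ S) • μ.restrict S) := by
        rw [lintegral_smul_measure, smul_eq_mul]
    _ ≤ kyFanNorm μ t f := by
        refine lintegral_le_kyFanNorm f ?_ (by simp [hmass])
        refine Measure.le_iff.2 fun E _ => ?_
        calc ENNReal.ofReal t / μ S * μ.restrict S E ≤ 1 * μ E :=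
              mul_le_mul' (ENNReal.div_le_of_le_mul (by simpa using hSt.le))
                (Measure.restrict_le_self E)
          _ = μ E := one_mul _

end KyFanNorm

open scoped Convolution ContDiff
open ContinuousLinearMap (lsmul)

section Landau

variable {F : Type*} [NormedAddCommGroup F] [NormedSpace ℝ F]

theorem mul_enorm_deriv_zero_le [CompleteSpace F] {g g' g'' : ℝ → F}
    (hg : ∀ s, HasDerivAt g (g' s) s) (hg' : ∀ s, HasDerivAt g' (g'' s) s) (hc : Continuous g'')
    (r : ℝ≥0) :
    r * ‖g' 0‖ₑ ≤ ‖g r‖ₑ + ‖g 0‖ₑ + r * ∫⁻ s in Ioc (0 : ℝ) r, ‖g'' s‖ₑ := by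
  have hderiv : ∀ s, HasDerivAt (fun s => ((r : ℝ) - s) • g' s + g s) (((r : ℝ) - s) • g'' s) s :=
    fun s => by
      simpa using (((hasDerivAt_id s).const_sub (r : ℝ)).fun_smul (hg' s)).fun_add (hg s)
  have htaylor : (r : ℝ) • g' 0 = g r - g 0 - ∫ s in Ioc (0 : ℝ) r, ((r : ℝ) - s) • g'' s := by
    rw [← intervalIntegral.integral_of_le r.coe_nonneg,
      intervalIntegral.integral_eq_sub_of_hasDerivAt (fun s _ => hderiv s)
        (Continuous.intervalIntegrable (by fun_prop) _ _)]
    simp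
  have hremainder : ‖∫ s in Ioc (0 : ℝ) r, ((r : ℝ) - s) • g'' s‖ₑ
      ≤ r * ∫⁻ s in Ioc (0 : ℝ) r, ‖g'' s‖ₑ := by
    rw [← lintegral_const_mul _ hc.enorm.measurable]
    refine (enorm_integral_le_lintegral_enorm _).trans
      (setLIntegral_mono' measurableSet_Ioc fun s hs => ?_)
    rw [enorm_smul, Real.enorm_of_nonneg (sub_nonneg.2 hs.2)]
    gcongr
    exact ENNReal.ofReal_le_of_le_toReal (by simpa using hs.1.le)
  calc r * ‖g' 0‖ₑ = ‖(r : ℝ) • g' 0‖ₑ := by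
        rw [enorm_smul, Real.enorm_of_nonneg r.coe_nonneg, ENNReal.ofReal_coe_nnreal]
    _ ≤ ‖g r - g 0‖ₑ + ‖∫ s in Ioc (0 : ℝ) r, ((r : ℝ) - s) • g'' s‖ₑ := htaylor ▸ enorm_sub_le
    _ ≤ _ := add_le_add enorm_sub_le hremainder

variable {E : Type*} [NormedAddCommGroup E] [NormedSpace ℝ E] [MeasurableSpace E] [BorelSpace E]
  {μ : Measure E} [μ.IsAddRightInvariant]

theorem mul_kyFanNorm_deriv_le [CompleteSpace F] (t : ℝ) (e : E) {w w₁ w₂ : E → F}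
    (hw : ∀ x (s : ℝ), HasDerivAt (fun s : ℝ => w (x + s • e)) (w₁ (x + s • e)) s)
    (hw₁ : ∀ x (s : ℝ), HasDerivAt (fun s : ℝ => w₁ (x + s • e)) (w₂ (x + s • e)) s)
    (hc : Continuous w) (hc₂ : Continuous w₂) (r : ℝ≥0) :
    r * kyFanNorm μ t (‖w₁ ·‖ₑ)
      ≤ 2 * kyFanNorm μ t (‖w ·‖ₑ) + r ^ 2 * kyFanNorm μ t (‖w₂ ·‖ₑ) := by
  have htranslate : ∀ (f : E → F), Continuous f → ∀ z,
      kyFanNorm μ t (fun x => ‖f (x + z)‖ₑ) ≤ kyFanNorm μ t (‖f ·‖ₑ) := fun f hf z =>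
    kyFanNorm_comp_le (measurePreserving_add_right μ z) (f := (‖f ·‖ₑ))
      hf.enorm.measurable.aemeasurable
  have hintegral : kyFanNorm μ t (fun x => ∫⁻ s in Ioc (0 : ℝ) r, ‖w₂ (x + s • e)‖ₑ)
      ≤ r * kyFanNorm μ t (‖w₂ ·‖ₑ) :=
    calc kyFanNorm μ t (fun x => ∫⁻ s in Ioc (0 : ℝ) r, ‖w₂ (x + s • e)‖ₑ)
        ≤ ∫⁻ s in Ioc (0 : ℝ) r, kyFanNorm μ t (fun x => ‖w₂ (x + s • e)‖ₑ) :=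
          kyFanNorm_lintegral_le (F := fun (s : ℝ) x => ‖w₂ (x + s • e)‖ₑ)
            (Continuous.enorm (by fun_prop)).measurable.aemeasurable
      _ ≤ ∫⁻ _ in Ioc (0 : ℝ) r, kyFanNorm μ t (‖w₂ ·‖ₑ) :=
          lintegral_mono fun _ => htranslate w₂ hc₂ _
      _ = r * kyFanNorm μ t (‖w₂ ·‖ₑ) := by simp [mul_comm]
  rw [← kyFanNorm_const_mul ENNReal.coe_ne_top]
  calc kyFanNorm μ t (fun x => r * ‖w₁ x‖ₑ)
      ≤ kyFanNorm μ t (fun x => (‖w (x + (r : ℝ) • e)‖ₑ + ‖w x‖ₑ)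
          + r * ∫⁻ s in Ioc (0 : ℝ) r, ‖w₂ (x + s • e)‖ₑ) :=
        kyFanNorm_mono fun x => by
          simpa using mul_enorm_deriv_zero_le (hw x) (hw₁ x) (by fun_prop) r
    _ ≤ kyFanNorm μ t (fun x => ‖w (x + (r : ℝ) • e)‖ₑ) + kyFanNorm μ t (‖w ·‖ₑ)
          + r * kyFanNorm μ t (fun x => ∫⁻ s in Ioc (0 : ℝ) r, ‖w₂ (x + s • e)‖ₑ) := by
        rw [← kyFanNorm_const_mul ENNReal.coe_ne_top]
        refine (kyFanNorm_add_le (Continuous.add ?_ hc.enorm).measurable.aemeasurable _).trans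
          (add_le_add_left (kyFanNorm_add_le ?_ _) _)
        · exact Continuous.enorm (by fun_prop)
        · exact (Continuous.enorm (by fun_prop)).measurable.aemeasurable
    _ ≤ kyFanNorm μ t (‖w ·‖ₑ) + kyFanNorm μ t (‖w ·‖ₑ) + r * (r * kyFanNorm μ t (‖w₂ ·‖ₑ)) := by
        gcongr
        exact htranslate w hc _
    _ = 2 * kyFanNorm μ t (‖w ·‖ₑ) + r ^ 2 * kyFanNorm μ t (‖w₂ ·‖ₑ) := by ring

end Landau

section Convolution

theorem kyFanNorm_convolution_le {G F : Type*} [AddCommGroup G] [MeasurableSpace G]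
    [MeasurableAdd₂ G] [MeasurableNeg G] {μ : Measure G} [SFinite μ] [μ.IsAddLeftInvariant]
    [μ.IsNegInvariant] [NormedAddCommGroup F] [NormedSpace ℝ F] (t : ℝ) {u : G → ℝ} {ψ : G → F}
    (hu : AEStronglyMeasurable u μ) (hψ : AEStronglyMeasurable ψ μ) :
    kyFanNorm μ t (‖(u ⋆[lsmul ℝ ℝ, μ] ψ) ·‖ₑ)
      ≤ (∫⁻ y, ‖ψ y‖ₑ ∂μ) * kyFanNorm μ t (‖u ·‖ₑ) := by
  have hpointwise : ∀ x, ‖(u ⋆[lsmul ℝ ℝ, μ] ψ) x‖ₑ ≤ ∫⁻ y, ‖ψ y‖ₑ * ‖u (x - y)‖ₑ ∂μ := by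
    intro x
    rw [convolution_lsmul_swap]
    refine (enorm_integral_le_lintegral_enorm _).trans_eq ?_
    simp only [enorm_smul, mul_comm]
  have hmeas : AEMeasurable (fun p : G × G => ‖ψ p.2‖ₑ * ‖u (p.1 - p.2)‖ₑ) (μ.prod μ) :=
    hψ.comp_snd.enorm.mul
      (hu.comp_quasiMeasurePreserving (quasiMeasurePreserving_sub_of_right_invariant μ μ)).enorm
  have htranslate : ∀ y, kyFanNorm μ t (fun x => ‖u (x - y)‖ₑ) ≤ kyFanNorm μ t (‖u ·‖ₑ) :=
    fun y => kyFanNorm_comp_le (measurePreserving_sub_right μ y) hu.enorm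
  calc kyFanNorm μ t (‖(u ⋆[lsmul ℝ ℝ, μ] ψ) ·‖ₑ)
      ≤ kyFanNorm μ t (fun x => ∫⁻ y, ‖ψ y‖ₑ * ‖u (x - y)‖ₑ ∂μ) := kyFanNorm_mono hpointwise
    _ ≤ ∫⁻ y, kyFanNorm μ t (fun x => ‖ψ y‖ₑ * ‖u (x - y)‖ₑ) ∂μ := kyFanNorm_lintegral_le hmeas
    _ ≤ ∫⁻ y, ‖ψ y‖ₑ * kyFanNorm μ t (‖u ·‖ₑ) ∂μ := lintegral_mono fun y => by
        rw [kyFanNorm_const_mul enorm_ne_top]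
        gcongr
        exact htranslate y
    _ = (∫⁻ y, ‖ψ y‖ₑ ∂μ) * kyFanNorm μ t (‖u ·‖ₑ) := lintegral_mul_const'' _ hψ.enorm

end Convolution

section IteratedDirDeriv

variable {E : Type*} [NormedAddCommGroup E] [NormedSpace ℝ E] {m : ℕ} {φ : E → ℝ}

/-- The iterated directional derivative `∂_{v₀} ⋯ ∂_{vₘ₋₁} φ`. -/
def iteratedDirDeriv (v : Fin m → E) (φ : E → ℝ) (x : E) : ℝ :=
  iteratedFDeriv ℝ m φ x v

theorem iteratedDirDeriv_zero (v : Fin 0 → E) (φ : E → ℝ) : iteratedDirDeriv v φ = φ := by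
  ext x
  simp [iteratedDirDeriv]

theorem contDiff_iteratedDirDeriv (hφ : ContDiff ℝ ∞ φ) (v : Fin m → E) :
    ContDiff ℝ ∞ (iteratedDirDeriv v φ) :=
  (ContinuousMultilinearMap.apply ℝ (fun _ : Fin m => E) ℝ v).contDiff.comp
    (hφ.iteratedFDeriv_right (by exact_mod_cast le_top))

theorem hasCompactSupport_iteratedDirDeriv (hφ : HasCompactSupport φ) (v : Fin m → E) :
    HasCompactSupport (iteratedDirDeriv v φ) :=
  (hφ.iteratedFDeriv (𝕜 := ℝ) m).comp_left
    (g := fun L : ContinuousMultilinearMap ℝ (fun _ : Fin m => E) ℝ => L v) rfl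

theorem fderiv_iteratedDirDeriv (hφ : ContDiff ℝ ∞ φ) (v : Fin m → E) (e x : E) :
    fderiv ℝ (iteratedDirDeriv v φ) x e = iteratedDirDeriv (Fin.cons e v) φ x := by
  have hdiff : DifferentiableAt ℝ (iteratedFDeriv ℝ m φ) x :=
    (hφ.iteratedFDeriv_right (m := 1) (by exact_mod_cast le_top)).differentiable one_ne_zero x
  have hcomp := (ContinuousMultilinearMap.apply ℝ (fun _ : Fin m => E) ℝ v).hasFDerivAt.comp x
    hdiff.hasFDerivAt
  change HasFDerivAt (iteratedDirDeriv v φ) _ x at hcomp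
  rw [hcomp.fderiv, iteratedDirDeriv, iteratedFDeriv_succ_apply_left]
  simp

theorem iteratedDirDeriv_comp_sub_left (hφ : ContDiff ℝ m φ) (v : Fin m → E) (a y : E) :
    iteratedDirDeriv v (fun z => φ (a - z)) y = (-1) ^ m * iteratedDirDeriv v φ (a - y) := by
  have hneg : (fun z => φ (a - z)) = (fun z => φ (a + z)) ∘ (-ContinuousLinearMap.id ℝ E) := by
    ext z
    simp [sub_eq_add_neg]
  have hφa : ContDiff ℝ m (fun z => φ (a + z)) := by fun_prop
  rw [iteratedDirDeriv, hneg, ContinuousLinearMap.iteratedFDeriv_comp_right _ hφa y le_rfl,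
    iteratedFDeriv_comp_add_left]
  simpa [sub_eq_add_neg, iteratedDirDeriv] using
    (iteratedFDeriv ℝ m φ (a - y)).map_smul_univ (fun _ => (-1 : ℝ)) v

variable [MeasurableSpace E] [BorelSpace E] {μ : Measure E} {u : E → ℝ}

theorem continuous_convolution_iteratedDirDeriv (hu : LocallyIntegrable u μ)
    (hφ : ContDiff ℝ ∞ φ) (hφc : HasCompactSupport φ) (v : Fin m → E) :
    Continuous (u ⋆[lsmul ℝ ℝ, μ] iteratedDirDeriv v φ) :=
  (hasCompactSupport_iteratedDirDeriv hφc v).continuous_convolution_right _ hu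
    (contDiff_iteratedDirDeriv hφ v).continuous

theorem hasDerivAt_convolution_iteratedDirDeriv [SFinite μ] [μ.IsAddLeftInvariant]
    (hu : LocallyIntegrable u μ) (hφ : ContDiff ℝ ∞ φ) (hφc : HasCompactSupport φ) (v : Fin m → E)
    (e x : E) (s : ℝ) :
    HasDerivAt (fun s : ℝ => (u ⋆[lsmul ℝ ℝ, μ] iteratedDirDeriv v φ) (x + s • e))
      ((u ⋆[lsmul ℝ ℝ, μ] iteratedDirDeriv (Fin.cons e v) φ) (x + s • e)) s := by
  have hc := hasCompactSupport_iteratedDirDeriv hφc v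
  have hd : ContDiff ℝ 1 (iteratedDirDeriv v φ) :=
    (contDiff_iteratedDirDeriv hφ v).of_le (by exact_mod_cast le_top)
  have hline : HasDerivAt (fun s : ℝ => x + s • e) e s := by
    simpa using ((hasDerivAt_id s).smul_const e).const_add x
  have h := (hc.hasFDerivAt_convolution_right (lsmul ℝ ℝ) hu hd (x + s • e)).comp_hasDerivAt s
    hline
  rw [convolution_precompR_apply _ hu (hc.fderiv ℝ) (hd.continuous_fderiv one_ne_zero)] at h
  simp only [fderiv_iteratedDirDeriv hφ] at h
  exact h

end IteratedDirDeriv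

section LogConvex

variable {R : Type*} [CommSemiring R] [LinearOrder R] [IsStrictOrderedRing R] {b : ℕ → R}

theorem pow_succ_le_of_sq_le_mul (hb : ∀ m, 0 ≤ b m)
    (h : ∀ m, b (m + 1) ^ 2 ≤ b m * b (m + 2)) (m : ℕ) :
    b m ^ (m + 1) ≤ b 0 * b (m + 1) ^ m := by
  induction m with
  | zero => simp
  | succ m ih =>
    rcases (hb (m + 1)).eq_or_lt with h0 | h0
    · rw [← h0, zero_pow (by omega)]
      exact mul_nonneg (hb _) (pow_nonneg (hb _) _)
    · refine le_of_mul_le_mul_right ?_ (pow_pos h0 m)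
      calc b (m + 1) ^ (m + 1 + 1) * b (m + 1) ^ m = (b (m + 1) ^ 2) ^ (m + 1) := by ring
        _ ≤ (b m * b (m + 2)) ^ (m + 1) := pow_le_pow_left₀ (pow_nonneg (hb _) _) (h m) _
        _ = b m ^ (m + 1) * b (m + 2) ^ (m + 1) := by ring
        _ ≤ b 0 * b (m + 1) ^ m * b (m + 2) ^ (m + 1) :=
          mul_le_mul_of_nonneg_right ih (pow_nonneg (hb _) _)
        _ = b 0 * b (m + 1 + 1) ^ (m + 1) * b (m + 1) ^ m := by ring_nf

theorem pow_add_le_of_sq_le_mul (hb : ∀ m, 0 ≤ b m)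
    (h : ∀ m, b (m + 1) ^ 2 ≤ b m * b (m + 2)) (j d : ℕ) :
    b j ^ (j + d) ≤ b 0 ^ d * b (j + d) ^ j := by
  induction d with
  | zero => simp
  | succ d ih =>
    rcases Nat.eq_zero_or_pos (j + d) with h0 | h0
    · obtain ⟨rfl, rfl⟩ : j = 0 ∧ d = 0 := by omega
      simp
    · have hR : 0 ≤ b 0 ^ (d + 1) * b (j + (d + 1)) ^ j :=
        mul_nonneg (pow_nonneg (hb _) _) (pow_nonneg (hb _) _)
      refine (pow_le_pow_iff_left₀ (pow_nonneg (hb _) _) hR h0.ne').1 ?_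
      calc (b j ^ (j + (d + 1))) ^ (j + d) = (b j ^ (j + d)) ^ (j + d + 1) := by ring
        _ ≤ (b 0 ^ d * b (j + d) ^ j) ^ (j + d + 1) :=
          pow_le_pow_left₀ (pow_nonneg (hb _) _) ih _
        _ = b 0 ^ (d * (j + d + 1)) * (b (j + d) ^ (j + d + 1)) ^ j := by ring
        _ ≤ b 0 ^ (d * (j + d + 1)) * (b 0 * b (j + d + 1) ^ (j + d)) ^ j :=
          mul_le_mul_of_nonneg_left (pow_le_pow_left₀ (pow_nonneg (hb _) _)
            (pow_succ_le_of_sq_le_mul hb h _) _) (pow_nonneg (hb _) _)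
        _ = (b 0 ^ (d + 1) * b (j + (d + 1)) ^ j) ^ (j + d) := by
          rw [← add_assoc]; ring

end LogConvex

section Interpolation

theorem sq_le_of_forall_mul_le {x p q : ℝ≥0} (h : ∀ r : ℝ≥0, r * x ≤ p + r ^ 2 * q) :
    x ^ 2 ≤ 4 * q * p := by
  have hquadratic : ∀ r : ℝ, 0 ≤ (q : ℝ) * (r * r) + -x * r + p := by
    intro r
    rcases le_or_gt 0 r with hr | hr
    · lift r to ℝ≥0 using hr
      have := NNReal.coe_le_coe.2 (h r)
      push_cast at this
      linarith
    · have : 0 ≤ x * -r := mul_nonneg x.coe_nonneg (by linarith)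
      have : 0 ≤ (q : ℝ) * (r * r) := mul_nonneg q.coe_nonneg (mul_self_nonneg r)
      linarith [p.coe_nonneg]
  have hdiscrim := discrim_le_zero hquadratic
  rw [discrim] at hdiscrim
  rw [← NNReal.coe_le_coe]
  push_cast
  linarith

theorem pow_le_of_forall_mul_le {a : ℕ → ℝ≥0}
    (h : ∀ m (r : ℝ≥0), r * a (m + 1) ≤ 2 * a m + r ^ 2 * a (m + 2)) (j d : ℕ) :
    a j ^ (j + d) ≤ (3 ^ ((j + d) * j)) ^ (j + d) * (a (j + d) ^ j * a 0 ^ d) := by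
  have hsq : ∀ m, a (m + 1) ^ 2 ≤ 9 * (a m * a (m + 2)) := fun m =>
    calc a (m + 1) ^ 2 ≤ 4 * a (m + 2) * (2 * a m) := sq_le_of_forall_mul_le (h m)
      _ = 8 * (a m * a (m + 2)) := by ring
      _ ≤ 9 * (a m * a (m + 2)) := by gcongr; norm_num
  -- the factor `3 ^ (m ^ 2)` absorbs the constant `9` and makes the sequence log-convex
  have hlogConvex := pow_add_le_of_sq_le_mul (b := fun m => 3 ^ (m ^ 2) * a m)
    (fun _ => zero_le) (fun m =>
      calc (3 ^ ((m + 1) ^ 2) * a (m + 1)) ^ 2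
          = 3 ^ (2 * (m + 1) ^ 2) * a (m + 1) ^ 2 := by ring
        _ ≤ 3 ^ (2 * (m + 1) ^ 2) * (9 * (a m * a (m + 2))) := by gcongr; exact hsq m
        _ = 3 ^ (m ^ 2) * a m * (3 ^ ((m + 2) ^ 2) * a (m + 2)) := by ring) j d
  calc a j ^ (j + d) ≤ (3 ^ (j ^ 2) * a j) ^ (j + d) := by
        gcongr
        exact le_mul_of_one_le_left zero_le (one_le_pow₀ (by norm_num))
    _ ≤ (3 ^ 0 ^ 2 * a 0) ^ d * (3 ^ ((j + d) ^ 2) * a (j + d)) ^ j := hlogConvex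
    _ = (3 ^ ((j + d) * j)) ^ (j + d) * (a (j + d) ^ j * a 0 ^ d) := by
        simp only [mul_pow]
        ring

theorem le_mul_rpow_mul_rpow_of_pow_le {x y z c : ℝ≥0∞} {j k : ℕ} (hk : k ≠ 0) (hjk : j ≤ k)
    (h : x ^ k ≤ c ^ k * (y ^ j * z ^ (k - j))) :
    x ≤ c * (y ^ ((j : ℝ) / k) * z ^ (1 - (j : ℝ) / k)) := by
  have hk' : (k : ℝ) ≠ 0 := Nat.cast_ne_zero.2 hk
  have hroot : (c * (y ^ ((j : ℝ) / k) * z ^ (1 - (j : ℝ) / k))) ^ k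
      = c ^ k * (y ^ j * z ^ (k - j)) := by
    simp only [mul_pow, ← ENNReal.rpow_mul_natCast, ← ENNReal.rpow_natCast y,
      ← ENNReal.rpow_natCast z, Nat.cast_sub hjk]
    congr 3 <;> field_simp
  exact (ENNReal.pow_le_pow_left_iff hk).1 (h.trans_eq hroot.symm)

theorem le_rpow_mul_rpow_of_forall_mul_le {a : ℕ → ℝ≥0∞} (ha : ∀ m, a m ≠ ⊤)
    (h : ∀ m (r : ℝ≥0), r * a (m + 1) ≤ 2 * a m + r ^ 2 * a (m + 2)) {j k : ℕ} (hk : k ≠ 0)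
    (hjk : j ≤ k) :
    a j ≤ 3 ^ (k * j) * (a k ^ ((j : ℝ) / k) * a 0 ^ (1 - (j : ℝ) / k)) := by
  lift a to ℕ → ℝ≥0 using ha
  beta_reduce at h ⊢
  have hpow := pow_le_of_forall_mul_le (a := a) (fun m r => by exact_mod_cast h m r) j (k - j)
  rw [Nat.add_sub_cancel' hjk] at hpow
  exact le_mul_rpow_mul_rpow_of_pow_le hk hjk (by exact_mod_cast hpow)

end Interpolation

section MollifiedDerivNorm

variable {E ι : Type*} [NormedAddCommGroup E] [NormedSpace ℝ E] [MeasurableSpace E]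
  {μ : Measure E} {t : ℝ} {b : ι → E} {u φ : E → ℝ} {m : ℕ}

/-- The size of the order-`m` derivatives of the mollification `u ⋆ φ` along the vectors `b i`: the
largest Ky Fan norm among the functions `∂_{b i₁} ⋯ ∂_{b iₘ} (u ⋆ φ)`. -/
def mollifiedDerivNorm (μ : Measure E) (t : ℝ) (b : ι → E) (u φ : E → ℝ) (m : ℕ) : ℝ≥0∞ :=
  ⨆ i : Fin m → ι, kyFanNorm μ t (‖(u ⋆[lsmul ℝ ℝ, μ] iteratedDirDeriv (b ∘ i) φ) ·‖ₑ)

theorem kyFanNorm_le_mollifiedDerivNorm (i : Fin m → ι) :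
    kyFanNorm μ t (‖(u ⋆[lsmul ℝ ℝ, μ] iteratedDirDeriv (b ∘ i) φ) ·‖ₑ)
      ≤ mollifiedDerivNorm μ t b u φ m :=
  le_iSup (fun i : Fin m → ι =>
    kyFanNorm μ t (‖(u ⋆[lsmul ℝ ℝ, μ] iteratedDirDeriv (b ∘ i) φ) ·‖ₑ)) i

variable [BorelSpace E]

theorem mul_mollifiedDerivNorm_succ_le [SFinite μ] [μ.IsAddLeftInvariant]
    (hu : LocallyIntegrable u μ) (hφ : ContDiff ℝ ∞ φ) (hφc : HasCompactSupport φ) (m : ℕ)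
    (r : ℝ≥0) :
    r * mollifiedDerivNorm μ t b u φ (m + 1)
      ≤ 2 * mollifiedDerivNorm μ t b u φ m + r ^ 2 * mollifiedDerivNorm μ t b u φ (m + 2) := by
  have hcontinuous : ∀ {m'} (i : Fin m' → ι),
      Continuous (u ⋆[lsmul ℝ ℝ, μ] iteratedDirDeriv (b ∘ i) φ) := fun i =>
    continuous_convolution_iteratedDirDeriv hu hφ hφc _
  have hderiv : ∀ {m'} (i : Fin m' → ι) (l : ι) (x : E) (s : ℝ),
      HasDerivAt (fun s : ℝ => (u ⋆[lsmul ℝ ℝ, μ] iteratedDirDeriv (b ∘ i) φ) (x + s • b l))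
        ((u ⋆[lsmul ℝ ℝ, μ] iteratedDirDeriv (b ∘ (Fin.cons l i : Fin (m' + 1) → ι)) φ)
          (x + s • b l)) s := fun i l x s => by
    rw [Fin.comp_cons]
    exact hasDerivAt_convolution_iteratedDirDeriv hu hφ hφc _ _ x s
  rw [mollifiedDerivNorm, ENNReal.mul_iSup]
  refine iSup_le fun i => ?_
  obtain ⟨l, i, rfl⟩ : ∃ l i', i = Fin.cons l i' := ⟨i 0, Fin.tail i, (Fin.cons_self_tail i).symm⟩
  refine (mul_kyFanNorm_deriv_le t (b l) (hderiv i l) (hderiv (Fin.cons l i) l) (hcontinuous _)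
    (hcontinuous _) r).trans ?_
  gcongr <;> exact kyFanNorm_le_mollifiedDerivNorm _

variable [SecondCountableTopology E] [SFinite μ] [μ.IsAddLeftInvariant] [μ.IsNegInvariant]

theorem mollifiedDerivNorm_ne_top [Finite ι] [IsFiniteMeasureOnCompacts μ]
    (hu : AEStronglyMeasurable u μ) (hφ : ContDiff ℝ ∞ φ) (hφc : HasCompactSupport φ)
    (hfin : kyFanNorm μ t (‖u ·‖ₑ) ≠ ⊤) : mollifiedDerivNorm μ t b u φ m ≠ ⊤ := by
  have := Fintype.ofFinite ι
  rw [mollifiedDerivNorm, ← Finset.sup_univ_eq_iSup]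
  refine ((Finset.sup_lt_iff ENNReal.zero_lt_top).2 fun i _ => ?_).ne
  have hint : Integrable (iteratedDirDeriv (b ∘ i) φ) μ :=
    (contDiff_iteratedDirDeriv hφ _).continuous.integrable_of_hasCompactSupport
      (hasCompactSupport_iteratedDirDeriv hφc _)
  exact (kyFanNorm_convolution_le t hu hint.1).trans_lt (ENNReal.mul_lt_top hint.2 hfin.lt_top)

theorem mollifiedDerivNorm_zero_le (hu : AEStronglyMeasurable u μ)
    (hφ : AEStronglyMeasurable φ μ) (hφ₁ : ∫⁻ y, ‖φ y‖ₑ ∂μ ≤ 1) :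
    mollifiedDerivNorm μ t b u φ 0 ≤ kyFanNorm μ t (‖u ·‖ₑ) := by
  refine iSup_le fun i => ?_
  rw [iteratedDirDeriv_zero]
  exact (kyFanNorm_convolution_le t hu hφ).trans (mul_le_of_le_one_left' hφ₁)

end MollifiedDerivNorm

section WeakGradient

variable {n j k m : ℕ} {u φ : RSpace n → ℝ} {t : ℝ}
  {v : RSpace n → EuclideanSpace ℝ (Fin k → Fin n)}
  {w : RSpace n → EuclideanSpace ℝ (Fin j → Fin n)}

theorem enorm_le_sum_enorm_apply {ι : Type*} [Fintype ι] (v : EuclideanSpace ℝ ι) :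
    ‖v‖ₑ ≤ ∑ i, ‖v i‖ₑ := by
  classical
  conv_lhs => rw [← (EuclideanSpace.basisFun ι ℝ).sum_repr v]
  refine (enorm_sum_le _ _).trans_eq ?_
  simp [← ofReal_norm, norm_smul]

theorem IsWeakGradient.aemeasurable_enorm (hv : IsWeakGradient k u v) :
    AEMeasurable (‖v ·‖ₑ) :=
  ((WithLp.measurable_toLp 2 _).comp_aemeasurable (aemeasurable_pi_lambda (fun x i => v x i)
    fun i => (hv i).1.aestronglyMeasurable.aemeasurable)).enorm

/-- The standard basis of `ℝⁿ`, whose directional derivatives are the partial derivatives. -/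
def unitVector (n : ℕ) (i : Fin n) : RSpace n :=
  EuclideanSpace.single i 1

theorem convolution_iteratedDirDeriv_of_isWeakGradient (hv : IsWeakGradient k u v)
    (hφ : ContDiff ℝ ∞ φ) (hφc : HasCompactSupport φ) (i : Fin k → Fin n) :
    u ⋆[lsmul ℝ ℝ] iteratedDirDeriv (unitVector n ∘ i) φ = (v · i) ⋆[lsmul ℝ ℝ] φ := by
  ext x
  have hweak : ∫ y, u y * iteratedDirDeriv (unitVector n ∘ i) (fun z => φ (x - z)) y
      = (-1) ^ k * ∫ y, v y i * φ (x - y) :=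
    (hv i).2 _ (by fun_prop) (hφc.comp_homeomorph (Homeomorph.subLeft x))
  simp only [iteratedDirDeriv_comp_sub_left (hφ.of_le (by exact_mod_cast le_top)),
    mul_left_comm _ ((-1 : ℝ) ^ k), integral_const_mul] at hweak
  exact mul_left_cancel₀ (pow_ne_zero k (by norm_num)) hweak

theorem mollifiedDerivNorm_le_of_isWeakGradient (hv : IsWeakGradient k u v)
    (hφ : ContDiff ℝ ∞ φ) (hφc : HasCompactSupport φ) (hφ₁ : ∫⁻ y, ‖φ y‖ₑ ≤ 1) :
    mollifiedDerivNorm volume t (unitVector n) u φ k ≤ kyFanNorm volume t (‖v ·‖ₑ) := by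
  refine iSup_le fun i => ?_
  rw [convolution_iteratedDirDeriv_of_isWeakGradient hv hφ hφc i]
  calc kyFanNorm volume t (‖((v · i) ⋆[lsmul ℝ ℝ] φ) ·‖ₑ)
      ≤ (∫⁻ y, ‖φ y‖ₑ) * kyFanNorm volume t (fun x => ‖v x i‖ₑ) :=
        kyFanNorm_convolution_le t (hv i).1.aestronglyMeasurable
          hφ.continuous.aestronglyMeasurable
    _ ≤ kyFanNorm volume t (fun x => ‖v x i‖ₑ) := mul_le_of_le_one_left' hφ₁
    _ ≤ kyFanNorm volume t (‖v ·‖ₑ) := kyFanNorm_mono fun x => PiLp.enorm_apply_le (v x) i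

theorem mollifiedDerivNorm_le_rpow_mul_rpow (hu : LocallyIntegrable u) (hk : k ≠ 0)
    (hjk : j ≤ k) (hv : IsWeakGradient k u v) (hφ : ContDiff ℝ ∞ φ) (hφc : HasCompactSupport φ)
    (hφ₁ : ∫⁻ y, ‖φ y‖ₑ ≤ 1) (hfin : kyFanNorm volume t (‖u ·‖ₑ) ≠ ⊤) :
    mollifiedDerivNorm volume t (unitVector n) u φ j
      ≤ 3 ^ (k * j) * (kyFanNorm volume t (‖v ·‖ₑ) ^ ((j : ℝ) / k)
        * kyFanNorm volume t (‖u ·‖ₑ) ^ (1 - (j : ℝ) / k)) := by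
  have hexponent : 0 ≤ 1 - (j : ℝ) / k :=
    sub_nonneg.2 (div_le_one_of_le₀ (by exact_mod_cast hjk) (by positivity))
  refine (le_rpow_mul_rpow_of_forall_mul_le
    (fun _ => mollifiedDerivNorm_ne_top hu.aestronglyMeasurable hφ hφc hfin)
    (mul_mollifiedDerivNorm_succ_le hu hφ hφc) hk hjk).trans ?_
  gcongr
  · exact mollifiedDerivNorm_le_of_isWeakGradient hv hφ hφc hφ₁
  · exact mollifiedDerivNorm_zero_le hu.aestronglyMeasurable
      hφ.continuous.aestronglyMeasurable hφ₁

theorem exists_mollifier_seq {E : Type*} [NormedAddCommGroup E] [NormedSpace ℝ E]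
    [FiniteDimensional ℝ E] [MeasurableSpace E] [BorelSpace E] {μ : Measure E} [μ.IsAddHaarMeasure]
    {g : E → ℝ} (hg : LocallyIntegrable g μ) :
    ∃ φ : ℕ → E → ℝ, (∀ l, ContDiff ℝ ∞ (φ l)) ∧ (∀ l, HasCompactSupport (φ l)) ∧
      (∀ l, ∫⁻ y, ‖φ l y‖ₑ ∂μ ≤ 1) ∧
      ∀ᵐ x ∂μ, Filter.Tendsto (fun l => (g ⋆[lsmul ℝ ℝ, μ] φ l) x) Filter.atTop (nhds (g x)) := by
  let Φ : ℕ → ContDiffBump (0 : E) := fun l =>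
    ⟨1 / (l + 1), 2 * (1 / (l + 1)), by positivity, lt_two_mul_self (by positivity)⟩
  have hrOut : Filter.Tendsto (fun l => (Φ l).rOut) Filter.atTop (nhds 0) := by
    simpa [Φ] using (tendsto_one_div_add_atTop_nhds_zero_nat (𝕜 := ℝ)).const_mul 2
  refine ⟨fun l => (Φ l).normed μ, fun l => (Φ l).contDiff_normed,
    fun l => (Φ l).hasCompactSupport_normed, fun l => ?_, ?_⟩
  · rw [← ofReal_integral_norm_eq_lintegral_enorm (Φ l).integrable_normed]
    simp only [Real.norm_of_nonneg ((Φ l).nonneg_normed _), (Φ l).integral_normed,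
      ENNReal.ofReal_one, le_rfl]
  · have hswap : ∀ l, g ⋆[lsmul ℝ ℝ, μ] (Φ l).normed μ = (Φ l).normed μ ⋆[lsmul ℝ ℝ, μ] g :=
      fun l => by
        ext x
        rw [convolution_lsmul_swap]
        simp only [convolution_def, ContinuousLinearMap.lsmul_apply, smul_eq_mul, mul_comm]
    simp only [hswap]
    exact ContDiffBump.ae_convolution_tendsto_right_of_locallyIntegrable hrOut
      (.of_forall fun l => le_refl (2 * (Φ l).rIn)) hg

theorem kyFanNorm_weakGradient_le (hu : LocallyIntegrable u) (hk : k ≠ 0) (hjk : j ≤ k)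
    (hw : IsWeakGradient j u w) (hv : IsWeakGradient k u v)
    (hfin : kyFanNorm volume t (‖u ·‖ₑ) ≠ ⊤) :
    kyFanNorm volume t (‖w ·‖ₑ)
      ≤ (n ^ j * 3 ^ (k * j) : ℕ) * (kyFanNorm volume t (‖v ·‖ₑ) ^ ((j : ℝ) / k)
        * kyFanNorm volume t (‖u ·‖ₑ) ^ (1 - (j : ℝ) / k)) := by
  set c := kyFanNorm volume t (‖v ·‖ₑ) ^ ((j : ℝ) / k)
    * kyFanNorm volume t (‖u ·‖ₑ) ^ (1 - (j : ℝ) / k)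
  have hcomponent : ∀ i, kyFanNorm volume t (fun x => ‖w x i‖ₑ) ≤ 3 ^ (k * j) * c := fun i => by
    obtain ⟨φ, hφ, hφc, hφ₁, hlim⟩ := exists_mollifier_seq (hw i).1
    refine kyFanNorm_le_of_ae_tendsto (F := fun l x => ‖((w · i) ⋆[lsmul ℝ ℝ] φ l) x‖ₑ)
      (fun l => ?_) (fun l => ?_) (hlim.mono fun x hx => hx.enorm)
    all_goals rw [← convolution_iteratedDirDeriv_of_isWeakGradient hw (hφ l) (hφc l) i]
    · exact (continuous_convolution_iteratedDirDeriv hu (hφ l) (hφc l) _).enorm.aemeasurable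
    · exact (kyFanNorm_le_mollifiedDerivNorm i).trans
        (mollifiedDerivNorm_le_rpow_mul_rpow hu hk hjk hv (hφ l) (hφc l) (hφ₁ l) hfin)
  calc kyFanNorm volume t (‖w ·‖ₑ)
      ≤ kyFanNorm volume t (fun x => ∑ i, ‖w x i‖ₑ) :=
        kyFanNorm_mono fun x => enorm_le_sum_enorm_apply (w x)
    _ ≤ ∑ i, kyFanNorm volume t (fun x => ‖w x i‖ₑ) :=
        kyFanNorm_sum_le _ fun i _ => (hw i).1.aestronglyMeasurable.enorm
    _ ≤ ∑ _i : Fin j → Fin n, 3 ^ (k * j) * c := Finset.sum_le_sum fun i _ => hcomponent i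
    _ = (n ^ j * 3 ^ (k * j) : ℕ) * c := by simp [mul_assoc]

end WeakGradient

section RearrangementInequality

variable {n j k : ℕ} {u : RSpace n → ℝ} {v : RSpace n → EuclideanSpace ℝ (Fin k → Fin n)}
  {w : RSpace n → EuclideanSpace ℝ (Fin j → Fin n)}

theorem mul_rpow_mul_mul_rpow_one_sub {θ : ℝ} (h₀ : 0 ≤ θ) (h₁ : θ ≤ 1) (c x y : ℝ≥0∞) :
    (c * x) ^ θ * (c * y) ^ (1 - θ) = c * (x ^ θ * y ^ (1 - θ)) := by
  have h₁' : 0 ≤ 1 - θ := sub_nonneg.2 h₁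
  rw [ENNReal.mul_rpow_of_nonneg _ _ h₀, ENNReal.mul_rpow_of_nonneg _ _ h₁', mul_mul_mul_comm,
    ← ENNReal.rpow_add_of_nonneg _ _ h₀ h₁', add_sub_cancel, ENNReal.rpow_one]

theorem kyFanNorm_le_mul_maximalRearrangement {α : Type*} [MeasurableSpace α] {μ : Measure α}
    {f : α → ℝ≥0∞} (hf : AEMeasurable f μ) {t : ℝ} (ht : 0 < t) :
    kyFanNorm μ t f ≤ ENNReal.ofReal t * maximalRearrangement μ f t :=
  (kyFanNorm_le_lintegral_rearrangement hf t).trans_eq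
    (ofReal_mul_maximalRearrangement μ f ht).symm

theorem rearrangement_weakGradient_le (hu : LocallyIntegrable u) (hk : k ≠ 0) (hjk : j ≤ k)
    (hw : IsWeakGradient j u w) (hv : IsWeakGradient k u v) {t : ℝ} (ht : 0 < t)
    (hfin : maximalRearrangement volume (‖u ·‖ₑ) t ≠ ⊤) :
    rearrangement volume (‖w ·‖ₑ) t
      ≤ (n ^ j * 3 ^ (k * j) : ℕ) * (maximalRearrangement volume (‖v ·‖ₑ) t ^ ((j : ℝ) / k)
        * maximalRearrangement volume (‖u ·‖ₑ) t ^ (1 - (j : ℝ) / k)) := by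
  have hθ : (j : ℝ) / k ≤ 1 := div_le_one_of_le₀ (by exact_mod_cast hjk) (by positivity)
  have : 0 ≤ 1 - (j : ℝ) / k := sub_nonneg.2 hθ
  have hNu := kyFanNorm_le_mul_maximalRearrangement hu.aestronglyMeasurable.enorm ht
  have hNv := kyFanNorm_le_mul_maximalRearrangement hv.aemeasurable_enorm ht
  have hNu_fin : kyFanNorm volume t (‖u ·‖ₑ) ≠ ⊤ :=
    ne_top_of_le_ne_top (ENNReal.mul_ne_top ENNReal.ofReal_ne_top hfin) hNu
  refine (ENNReal.mul_le_mul_iff_right (ENNReal.ofReal_pos.2 ht).ne' ENNReal.ofReal_ne_top).1 ?_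
  calc ENNReal.ofReal t * rearrangement volume (‖w ·‖ₑ) t
      ≤ kyFanNorm volume t (‖w ·‖ₑ) :=
        ofReal_mul_rearrangement_le_kyFanNorm hw.aemeasurable_enorm t
    _ ≤ (n ^ j * 3 ^ (k * j) : ℕ) * (kyFanNorm volume t (‖v ·‖ₑ) ^ ((j : ℝ) / k)
          * kyFanNorm volume t (‖u ·‖ₑ) ^ (1 - (j : ℝ) / k)) :=
        kyFanNorm_weakGradient_le hu hk hjk hw hv hNu_fin
    _ ≤ (n ^ j * 3 ^ (k * j) : ℕ)
          * ((ENNReal.ofReal t * maximalRearrangement volume (‖v ·‖ₑ) t) ^ ((j : ℝ) / k)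
          * (ENNReal.ofReal t * maximalRearrangement volume (‖u ·‖ₑ) t) ^ (1 - (j : ℝ) / k)) := by
        gcongr
    _ = _ := by rw [mul_rpow_mul_mul_rpow_one_sub (by positivity) hθ, mul_left_comm]

theorem maximalRearrangement_le_radialRearrangement {α : Type*} [MeasurableSpace α]
    (μ : Measure α) (f : α → ℝ≥0∞) {x : RSpace n} (hx : x ≠ 0) :
    maximalRearrangement μ f (volume (Metric.ball (0 : RSpace n) ‖x‖)).toReal
      ≤ radialRearrangement n (maximalRearrangement μ f) x :=
  maximalRearrangement_le_rearrangement μ f <| ENNReal.toReal_pos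
    (Metric.measure_ball_pos _ _ (norm_pos_iff.2 hx)).ne' measure_ball_lt_top.ne

theorem norm_weakGradient_le (hn : 1 ≤ n) {ρ : (RSpace n → ℝ≥0∞) → ℝ≥0∞}
    (hρ : IsRIBanachFunctionNorm volume ρ) (hu : LocallyIntegrable u) (hk : k ≠ 0) (hjk : j ≤ k)
    (hw : IsWeakGradient j u w) (hv : IsWeakGradient k u v)
    (hfin : ∀ᵐ x, radialRearrangement n (maximalRearrangement volume (‖u ·‖ₑ)) x < ⊤) :
    ρ (‖w ·‖ₑ) ≤ (n ^ j * 3 ^ (k * j) : ℕ) * ρ (fun x =>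
      radialRearrangement n (maximalRearrangement volume (‖u ·‖ₑ)) x ^ (1 - (j : ℝ) / k)
        * radialRearrangement n (maximalRearrangement volume (‖v ·‖ₑ)) x ^ ((j : ℝ) / k)) := by
  have : Nonempty (Fin n) := ⟨⟨0, hn⟩⟩
  set Ru := radialRearrangement n (maximalRearrangement volume (‖u ·‖ₑ))
  set Rv := radialRearrangement n (maximalRearrangement volume (‖v ·‖ₑ))
  have hθ' : 0 ≤ 1 - (j : ℝ) / k :=
    sub_nonneg.2 (div_le_one_of_le₀ (by exact_mod_cast hjk) (by positivity))
  have hmeas : AEMeasurable (fun x => Ru x ^ (1 - (j : ℝ) / k) * Rv x ^ ((j : ℝ) / k)) :=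
    (((measurable_radialRearrangement n _).pow_const _).mul
      ((measurable_radialRearrangement n _).pow_const _)).aemeasurable
  have hpointwise : radialRearrangement n (rearrangement volume (‖w ·‖ₑ)) ≤ᵐ[volume]
      fun x => (n ^ j * 3 ^ (k * j) : ℕ) * (Ru x ^ (1 - (j : ℝ) / k) * Rv x ^ ((j : ℝ) / k)) := by
    filter_upwards [hfin, Measure.ae_ne volume 0] with x hRu hx
    have hu_le : maximalRearrangement volume (‖u ·‖ₑ) _ ≤ Ru x :=
      maximalRearrangement_le_radialRearrangement _ _ hx
    have hv_le : maximalRearrangement volume (‖v ·‖ₑ) _ ≤ Rv x :=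
      maximalRearrangement_le_radialRearrangement _ _ hx
    have ht : 0 < (volume (Metric.ball (0 : RSpace n) ‖x‖)).toReal := ENNReal.toReal_pos
      (Metric.measure_ball_pos _ _ (norm_pos_iff.2 hx)).ne' measure_ball_lt_top.ne
    rw [radialRearrangement_rearrangement, mul_comm (Ru x ^ _)]
    refine (rearrangement_weakGradient_le hu hk hjk hw hv ht
      (hu_le.trans_lt hRu).ne).trans ?_
    gcongr
  calc ρ (‖w ·‖ₑ) = ρ (radialRearrangement n (rearrangement volume (‖w ·‖ₑ))) :=
        (representation_rearrangement hn hρ hw.aemeasurable_enorm).symm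
    _ ≤ ρ (fun x => ((n ^ j * 3 ^ (k * j) : ℕ) : ℝ≥0)
          * (Ru x ^ (1 - (j : ℝ) / k) * Rv x ^ ((j : ℝ) / k))) :=
        hρ.mono _ _ (measurable_radialRearrangement n _).aemeasurable (hmeas.const_mul _)
          (by simpa using hpointwise)
    _ = _ := by rw [hρ.smul _ _ hmeas, ENNReal.coe_natCast]

end RearrangementInequality

section Multiplier

theorem convexification_rpow {α : Type*} (ρ : (α → ℝ≥0∞) → ℝ≥0∞) {θ : ℝ} (hθ : θ ≠ 0)
    (f : α → ℝ≥0∞) : convexification ρ (1 / θ) (fun x => f x ^ θ) = ρ f ^ θ := by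
  simp only [convexification, ← ENNReal.rpow_mul, mul_one_div_cancel hθ, ENNReal.rpow_one,
    one_div_one_div]

theorem rpow_convexification {α : Type*} (ρ : (α → ℝ≥0∞) → ℝ≥0∞) {b : ℝ} (hb : b ≠ 0)
    (f : α → ℝ≥0∞) : convexification ρ b f ^ b = ρ (fun x => f x ^ b) := by
  rw [convexification, ← ENNReal.rpow_mul, one_div_mul_cancel hb, ENNReal.rpow_one]

variable {α : Type*} [MeasurableSpace α] {μ : Measure α} {ρ ρX ρY ρW : (α → ℝ≥0∞) → ℝ≥0∞}
  {f g : α → ℝ≥0∞}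

/-- Positively homogeneous functionals that are definite and finite on the indicators of sets of
finite measure. Unlike Banach function norms, they are stable under all convexifications, which
for exponents below `1` destroy the triangle inequality. -/
structure IsHomogeneousFunctionNorm (μ : Measure α) (ρ : (α → ℝ≥0∞) → ℝ≥0∞) : Prop where
  eq_zero_iff : ∀ f, AEMeasurable f μ → (ρ f = 0 ↔ f =ᵐ[μ] 0)
  smul : ∀ (c : ℝ≥0) (f), AEMeasurable f μ → ρ (fun x => c * f x) = c * ρ f
  indicator_lt_top : ∀ E, MeasurableSet E → μ E < ⊤ → ρ (E.indicator fun _ => 1) < ⊤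

theorem IsBanachFunctionNorm.isHomogeneousFunctionNorm (hρ : IsBanachFunctionNorm μ ρ) :
    IsHomogeneousFunctionNorm μ ρ :=
  ⟨hρ.eq_zero_iff, hρ.smul, hρ.indicator_lt_top⟩

theorem IsHomogeneousFunctionNorm.convexification (hρ : IsHomogeneousFunctionNorm μ ρ) {b : ℝ}
    (hb : 0 < b) : IsHomogeneousFunctionNorm μ (convexification ρ b) where
  eq_zero_iff f hf := by
    rw [_root_.convexification, ENNReal.rpow_eq_zero_iff_of_pos (by positivity),
      hρ.eq_zero_iff _ (hf.pow_const b)]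
    exact Filter.eventually_congr (.of_forall fun x => ENNReal.rpow_eq_zero_iff_of_pos hb)
  smul c f hf := by
    simp only [_root_.convexification, ENNReal.mul_rpow_of_nonneg _ _ hb.le]
    rw [← ENNReal.coe_rpow_of_nonneg _ hb.le, hρ.smul _ _ (hf.pow_const b),
      ENNReal.mul_rpow_of_nonneg _ _ (by positivity), ENNReal.coe_rpow_of_nonneg _ hb.le,
      ← ENNReal.rpow_mul, mul_one_div_cancel hb.ne', ENNReal.rpow_one]
  indicator_lt_top E hE hEfin := by
    have hpow : (fun x => E.indicator (fun _ => (1 : ℝ≥0∞)) x ^ b) = E.indicator fun _ => 1 := by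
      ext x
      by_cases hx : x ∈ E <;> simp [hx, hb]
    rw [_root_.convexification, hpow]
    exact ENNReal.rpow_lt_top_of_nonneg (by positivity) (hρ.indicator_lt_top E hE hEfin).ne

theorem IsBanachFunctionNorm.ae_lt_top [SigmaFinite μ] (hρ : IsBanachFunctionNorm μ ρ)
    (hf : AEMeasurable f μ) (h : ρ f ≠ ⊤) : ∀ᵐ x ∂μ, f x < ⊤ := by
  refine ae_of_forall_measure_lt_top_ae_restrict _ fun E hE hEfin => ?_
  obtain ⟨C, hC⟩ := hρ.setLIntegral_le E hE hEfin
  exact ae_lt_top' hf.restrict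
    (ne_top_of_le_ne_top (ENNReal.mul_ne_top ENNReal.coe_ne_top h) (hC f hf))

theorem le_multiplierNorm (hg : AEMeasurable g μ) (hg₁ : ρW g ≤ 1) :
    ρX (fun x => f x * g x) ≤ multiplierNorm μ ρW ρX f :=
  le_iSup₂_of_le g hg (le_iSup_of_le hg₁ le_rfl)

theorem norm_mul_le_multiplierNorm_mul_of_ne_top (hX : IsHomogeneousFunctionNorm μ ρX)
    (hW : IsHomogeneousFunctionNorm μ ρW) (hf : AEMeasurable f μ) (hg : AEMeasurable g μ)
    (hfin : ρW g ≠ ⊤) : ρX (fun x => f x * g x) ≤ multiplierNorm μ ρW ρX f * ρW g := by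
  obtain ⟨c, hc⟩ : ∃ c : ℝ≥0, (c : ℝ≥0∞) = ρW g := ⟨_, ENNReal.coe_toNNReal hfin⟩
  rcases eq_or_ne c 0 with rfl | hc0
  · have hg0 : g =ᵐ[μ] 0 := (hW.eq_zero_iff g hg).1 hc.symm
    rw [(hX.eq_zero_iff (fun x => f x * g x) (hf.mul hg)).2 (hg0.mono fun x hx => by simp [hx])]
    exact zero_le
  · have hunit : ρW (fun x => (c⁻¹ : ℝ≥0) * g x) ≤ 1 := by
      rw [hW.smul _ _ hg, ← hc, ← ENNReal.coe_mul, inv_mul_cancel₀ hc0, ENNReal.coe_one]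
    calc ρX (fun x => f x * g x) = ρX (fun x => c * (f x * ((c⁻¹ : ℝ≥0) * g x))) := by
          congr 1 with x
          rw [mul_left_comm (f x), ← mul_assoc, ← ENNReal.coe_mul, mul_inv_cancel₀ hc0,
            ENNReal.coe_one, one_mul]
      _ = c * ρX (fun x => f x * ((c⁻¹ : ℝ≥0) * g x)) :=
          hX.smul _ _ (hf.mul (hg.const_mul _))
      _ ≤ c * multiplierNorm μ ρW ρX f := by
          gcongr
          exact le_multiplierNorm (hg.const_mul _) hunit
      _ = multiplierNorm μ ρW ρX f * ρW g := by rw [hc, mul_comm]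

theorem norm_indicator_le_multiplierNorm_mul (hX : IsHomogeneousFunctionNorm μ ρX)
    (hW : IsHomogeneousFunctionNorm μ ρW) (hf : AEMeasurable f μ) {E : Set α}
    (hE : MeasurableSet E) (hEfin : μ E < ⊤) :
    ρX (E.indicator f) ≤ multiplierNorm μ ρW ρX f * ρW (E.indicator fun _ => 1) := by
  have hmul : E.indicator f = fun x => f x * E.indicator (fun _ => 1) x := by
    ext x
    by_cases hx : x ∈ E <;> simp [hx]
  rw [hmul]
  exact norm_mul_le_multiplierNorm_mul_of_ne_top hX hW hf
    (measurable_const.indicator hE).aemeasurable (hW.indicator_lt_top E hE hEfin).ne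

theorem ae_lt_top_of_multiplierNorm_ne_top [SigmaFinite μ] (hX : IsBanachFunctionNorm μ ρX)
    (hW : IsHomogeneousFunctionNorm μ ρW) (hf : AEMeasurable f μ)
    (h : multiplierNorm μ ρW ρX f ≠ ⊤) : ∀ᵐ x ∂μ, f x < ⊤ := by
  refine ae_of_forall_measure_lt_top_ae_restrict _ fun E hE hEfin => ?_
  have hfin : ρX (E.indicator f) ≠ ⊤ := ne_top_of_le_ne_top
    (ENNReal.mul_ne_top h (hW.indicator_lt_top E hE hEfin).ne)
    (norm_indicator_le_multiplierNorm_mul hX.isHomogeneousFunctionNorm hW hf hE hEfin)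
  rw [ae_restrict_iff' hE]
  filter_upwards [hX.ae_lt_top (hf.indicator hE) hfin] with x hx hxE
  rwa [indicator_of_mem hxE] at hx

theorem ae_eq_zero_of_multiplierNorm_eq_zero [SigmaFinite μ]
    (hX : IsHomogeneousFunctionNorm μ ρX) (hW : IsHomogeneousFunctionNorm μ ρW)
    (hf : AEMeasurable f μ) (h : multiplierNorm μ ρW ρX f = 0) : f =ᵐ[μ] 0 := by
  refine ae_of_forall_measure_lt_top_ae_restrict _ fun E hE hEfin => ?_
  have hzero : ρX (E.indicator f) = 0 := by
    simpa [h] using norm_indicator_le_multiplierNorm_mul hX hW hf hE hEfin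
  rw [ae_restrict_iff' hE]
  filter_upwards [(hX.eq_zero_iff _ (hf.indicator hE)).1 hzero] with x hx hxE
  rwa [indicator_of_mem hxE] at hx

theorem norm_mul_le_multiplierNorm_mul [SigmaFinite μ] (hX : IsHomogeneousFunctionNorm μ ρX)
    (hW : IsHomogeneousFunctionNorm μ ρW) (hf : AEMeasurable f μ) (hg : AEMeasurable g μ) :
    ρX (fun x => f x * g x) ≤ multiplierNorm μ ρW ρX f * ρW g := by
  rcases eq_or_ne (ρW g) ⊤ with htop | hfin
  · rcases eq_or_ne (multiplierNorm μ ρW ρX f) 0 with hM | hM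
    · have hf0 : f =ᵐ[μ] 0 := ae_eq_zero_of_multiplierNorm_eq_zero hX hW hf hM
      rw [(hX.eq_zero_iff (fun x => f x * g x) (hf.mul hg)).2 (hf0.mono fun x hx => by simp [hx])]
      exact zero_le
    · rw [htop, ENNReal.mul_top hM]
      exact le_top
  · exact norm_mul_le_multiplierNorm_mul_of_ne_top hX hW hf hg hfin

theorem norm_rpow_mul_rpow_le [SigmaFinite μ] (hX : IsHomogeneousFunctionNorm μ ρX)
    (hY : IsHomogeneousFunctionNorm μ ρY) {θ : ℝ} (h₀ : 0 < θ) (h₁ : θ ≠ 1)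
    (hf : AEMeasurable f μ) (hg : AEMeasurable g μ) :
    ρX (fun x => f x ^ (1 - θ) * g x ^ θ) ≤ ρY g ^ θ *
      convexification (multiplierNorm μ (convexification ρY (1 / θ)) ρX) (1 - θ) f ^ (1 - θ) := by
  rw [rpow_convexification _ (sub_ne_zero.2 h₁.symm), ← convexification_rpow ρY h₀.ne' g, mul_comm]
  exact norm_mul_le_multiplierNorm_mul hX (hY.convexification (one_div_pos.2 h₀))
    (hf.pow_const _) (hg.pow_const _)

theorem ae_lt_top_of_convexification_multiplierNorm_ne_top [SigmaFinite μ]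
    (hX : IsBanachFunctionNorm μ ρX) (hW : IsHomogeneousFunctionNorm μ ρW) {b : ℝ} (hb : 0 < b)
    (hf : AEMeasurable f μ) (h : convexification (multiplierNorm μ ρW ρX) b f ≠ ⊤) :
    ∀ᵐ x ∂μ, f x < ⊤ := by
  have hpow : multiplierNorm μ ρW ρX (fun x => f x ^ b) ≠ ⊤ := by
    rw [← rpow_convexification (multiplierNorm μ ρW ρX) hb.ne' f]
    exact ENNReal.rpow_ne_top_of_nonneg hb.le h
  exact (ae_lt_top_of_multiplierNorm_ne_top hX hW (hf.pow_const b) hpow).mono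
    fun _ => (ENNReal.rpow_lt_top_iff_of_pos hb).1

end Multiplier

theorem theorem1p2_general {n j k : ℕ} (hn : 1 ≤ n) (hj : 1 ≤ j) (hjk : j < k)
    {ρX ρY : (RSpace n → ℝ≥0∞) → ℝ≥0∞} (hX : IsRIBanachFunctionNorm volume ρX)
    (hY : IsHomogeneousFunctionNorm volume ρY) {u : RSpace n → ℝ} (hu : LocallyIntegrable u)
    {Dj : RSpace n → EuclideanSpace ℝ (Fin j → Fin n)} (hDj : IsWeakGradient j u Dj)
    {Dk : RSpace n → EuclideanSpace ℝ (Fin k → Fin n)} (hDk : IsWeakGradient k u Dk)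
    {A B : ℝ≥0∞} (hA : A = representation ρY (maximalRearrangement volume (‖Dk ·‖ₑ)))
    (hB : B = representation
      (convexification (multiplierNorm volume (convexification ρY ((k : ℝ) / j)) ρX)
        (1 - (j : ℝ) / k)) (maximalRearrangement volume (‖u ·‖ₑ)))
    (hAB : ¬ (A = 0 ∧ B = ⊤)) :
    ρX (‖Dj ·‖ₑ) ≤ (n ^ j * 3 ^ (k * j) : ℕ) * A ^ ((j : ℝ) / k) * B ^ (1 - (j : ℝ) / k) := by
  have hj₀ : (0 : ℝ) < j := Nat.cast_pos.2 hj
  have hk₀ : (0 : ℝ) < k := hj₀.trans (Nat.cast_lt.2 hjk)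
  have hθ₀ : 0 < (j : ℝ) / k := div_pos hj₀ hk₀
  have hθ₁ : (j : ℝ) / k < 1 := (div_lt_one hk₀).2 (Nat.cast_lt.2 hjk)
  rw [← one_div_div (j : ℝ) k] at hB
  have hmeas (h : ℝ → ℝ≥0∞) : AEMeasurable (radialRearrangement n h) :=
    (measurable_radialRearrangement n h).aemeasurable
  rcases eq_or_ne B ⊤ with hB_top | hB_fin
  · have hA₀ : A ^ ((j : ℝ) / k) ≠ 0 := fun h =>
      hAB ⟨(ENNReal.rpow_eq_zero_iff_of_pos hθ₀).1 h, hB_top⟩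
    have hC₀ : ((n ^ j * 3 ^ (k * j) : ℕ) : ℝ≥0∞) ≠ 0 := Nat.cast_ne_zero.2 (by positivity)
    rw [hB_top, ENNReal.top_rpow_of_pos (sub_pos.2 hθ₁), ENNReal.mul_top (mul_ne_zero hC₀ hA₀)]
    exact le_top
  have hu_fin := ae_lt_top_of_convexification_multiplierNorm_ne_top hX.toIsBanachFunctionNorm
    (hY.convexification (one_div_pos.2 hθ₀)) (sub_pos.2 hθ₁) (hmeas _) (hB ▸ hB_fin)
  refine (norm_weakGradient_le hn hX hu (by omega) hjk.le hDj hDk hu_fin).trans ?_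
  rw [mul_assoc, hA, hB]
  gcongr
  exact norm_rpow_mul_rpow_le hX.toIsBanachFunctionNorm.isHomogeneousFunctionNorm hY hθ₀ hθ₁.ne
    (hmeas _) (hmeas _)

end

open MeasureTheory ENNReal NNReal in
/-- Gagliardo--Nirenberg inequality for rearrangement-invariant Banach function spaces. -/
theorem theorem1p2 (n j k : ℕ) (hn : 1 ≤ n) (hj : 1 ≤ j) (hjk : j < k)
    (ρX ρY : (RSpace n → ℝ≥0∞) → ℝ≥0∞)
    (hX : IsRIBanachFunctionNorm volume ρX) (hY : IsRIBanachFunctionNorm volume ρY)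
    (hYX : LocallyEmbedded volume (convexification ρY ((k : ℝ) / j)) ρX) :
    ∃ C : ℝ≥0, ∀ (u : RSpace n → ℝ)
      (Dj : RSpace n → EuclideanSpace ℝ (Fin j → Fin n))
      (Dk : RSpace n → EuclideanSpace ℝ (Fin k → Fin n)),
      WeaklyDifferentiable k u → IsWeakGradient j u Dj → IsWeakGradient k u Dk →
      ∀ A B : ℝ≥0∞,
      A = representation ρY (maximalRearrangement volume fun x => ‖Dk x‖ₑ) →
      B = representation
        (convexification
          (multiplierNorm volume (convexification ρY ((k : ℝ) / j)) ρX) (1 - (j : ℝ) / k))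
        (maximalRearrangement volume fun x => ‖u x‖ₑ) →
      -- the indeterminate product `0 * ∞` on the right-hand side is excluded
      ¬ (A = 0 ∧ B = ∞) →
      ρX (fun x => ‖Dj x‖ₑ) ≤ C * A ^ ((j : ℝ) / k) * B ^ (1 - (j : ℝ) / k) :=
  ⟨(n ^ j * 3 ^ (k * j) : ℕ), fun _ _ _ hu hDj hDk _ _ hA hB hAB =>
    theorem1p2_general hn hj hjk hX hY.toIsBanachFunctionNorm.isHomogeneousFunctionNorm hu.1 hDj
      hDk hA hB hAB⟩
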